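/- Work over $\mathbb C$. Let $d\ge 1$, let $\nu_d:\mathbb P^2\to\mathbb P^N$, $N=d(d+3)/2$, be the $d$-th Veronese map (given by all monomials of degree $d$), and let $X=\nu_d(\mathbb P^2)$. For points $P,P_1,\dots,P_k\in\mathbb P^N$ write $P=P_1+\dots+P_k$ if the $P_i$ have representative vectors whose sum is a representative vector of $P$. The rank of $P\in\mathbb P^N$ is the minimum $k$ for which there is an expression $P=P_1+\dots+P_k$ with all $P_i\in X$. A point $P$ of rank $k$ is identifiable if it has exactly one expression as a sum of $k$ points of $X$, up to permutation of these points of $\mathbb P^N$. A finite set $Z\subset\mathbb P^2$ is in general uniform position if, for every integer $u\ge 0$, no subset of $Z$ with at least $\binom{u+2}{2}$ points is contained in the zero locus of a nonzero form of degree $u$. Theorem. Let $P\in\mathbb P^N$ be a point of rank $k$ and let $x_1,\dots,x_k\in\mathbb P^2$ be points with $P=\nu_d(x_1)+\dots+\nu_d(x_k)$. Assume that the set $Z=\{x_1,\dots,x_k\}$ is in general uniform position and that $k<\dfrac{d^2+2d}{8}$. Then $P$ is identifiable. -/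

import Mathlib

open scoped LinearAlgebra.Projectivization

/-- Affine coordinates of the space containing the `d`-th Veronese variety of `ℙⁿ`: one coordinate
for each monomial of degree `d` in `n + 1` variables, a monomial being recorded as an unordered
`d`-tuple of variables. This is a complex vector space of dimension `(n + d).choose n`. -/
abbrev VeroneseSpace (n d : ℕ) : Type := Sym (Fin (n + 1)) d → ℂ

/-- The values at `v` of all the monomials of degree `d` in `n + 1` variables. -/
noncomputable def veroneseVec (n d : ℕ) (v : Fin (n + 1) → ℂ) : VeroneseSpace n d :=
  fun s => ((s : Multiset (Fin (n + 1))).map v).prod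

theorem veroneseVec_ne_zero (n d : ℕ) {v : Fin (n + 1) → ℂ} (hv : v ≠ 0) :
    veroneseVec n d v ≠ 0 := by
  obtain ⟨i, hi⟩ := Function.ne_iff.mp hv
  intro h
  have h1 := congrFun h (Sym.replicate d i)
  simp only [veroneseVec, Sym.coe_replicate, Multiset.map_replicate, Multiset.prod_replicate,
    Pi.zero_apply] at h1
  exact pow_ne_zero d hi h1

theorem veroneseVec_smul (n d : ℕ) (t : ℂ) (v : Fin (n + 1) → ℂ) :
    veroneseVec n d (t • v) = t ^ d • veroneseVec n d v := by
  funext s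
  simp [veroneseVec, Multiset.prod_map_mul]

/-- The `d`-th Veronese map `ν_d` from `ℙⁿ` to `ℙᴺ`, where `N + 1 = (n + d).choose n`. -/
noncomputable def veronese (n d : ℕ) : ℙ ℂ (Fin (n + 1) → ℂ) → ℙ ℂ (VeroneseSpace n d) :=
  Projectivization.lift
    (fun v => Projectivization.mk ℂ (veroneseVec n d v.1) (veroneseVec_ne_zero n d v.2))
    (by
      rintro ⟨a, ha⟩ ⟨b, hb⟩ t h
      refine (Projectivization.mk_eq_mk_iff' ℂ _ _ _ _).mpr ⟨t ^ d, ?_⟩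
      exact (veroneseVec_smul n d t b).symm.trans (congrArg (veroneseVec n d) h.symm))

/-- The Veronese variety `ν_d(ℙⁿ)`. -/
def veroneseVariety (n d : ℕ) : Set (ℙ ℂ (VeroneseSpace n d)) :=
  Set.range (veronese n d)

/-- `P = p₁ + ⋯ + p_k` for points of a projective space: the `p_i` have representative vectors
whose sum is a representative vector of `P`. -/
def IsSumOf {V : Type*} [AddCommGroup V] [Module ℂ V] (P : ℙ ℂ V) {k : ℕ} (p : Fin k → ℙ ℂ V) :
    Prop :=
  ∃ w : Fin k → V, (∀ i, ∃ h : w i ≠ 0, Projectivization.mk ℂ (w i) h = p i) ∧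
    ∃ h : ∑ i, w i ≠ 0, Projectivization.mk ℂ (∑ i, w i) h = P

/-- `P` has rank `k` with respect to `X`: the least number of points of `X` of which `P` is a
sum is `k`. -/
def HasRank {V : Type*} [AddCommGroup V] [Module ℂ V] (X : Set (ℙ ℂ V)) (P : ℙ ℂ V) (k : ℕ) :
    Prop :=
  IsLeast {l : ℕ | ∃ p : Fin l → ℙ ℂ V, (∀ i, p i ∈ X) ∧ IsSumOf P p} k

/-- `P` is identifiable with respect to `X`: if `k` is the rank of `P`, there is exactly one
expression of `P` as a sum of `k` points of `X`, up to a permutation of the points. (The scaling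
of the summands is already divided out, since they are points of a projective space.) -/
def IsIdentifiable {V : Type*} [AddCommGroup V] [Module ℂ V] (X : Set (ℙ ℂ V)) (P : ℙ ℂ V) :
    Prop :=
  ∃ k : ℕ, HasRank X P k ∧
    ∃ p : Fin k → ℙ ℂ V, (∀ i, p i ∈ X) ∧ IsSumOf P p ∧
      ∀ q : Fin k → ℙ ℂ V, (∀ i, q i ∈ X) → IsSumOf P q →
        ∃ σ : Equiv.Perm (Fin k), ∀ i, q i = p (σ i)

/-- The point `p` of `ℙⁿ` lies on the hypersurface with equation `F = 0` (for a form `F`). -/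
def LiesOn {n : ℕ} (p : ℙ ℂ (Fin (n + 1) → ℂ)) (F : MvPolynomial (Fin (n + 1)) ℂ) : Prop :=
  ∀ (v : Fin (n + 1) → ℂ) (hv : v ≠ 0), Projectivization.mk ℂ v hv = p →
    MvPolynomial.eval v F = 0

/-- General uniform position of a (finite) set `Z` of points of `ℙⁿ`: a subset of `m` points of `Z`
is contained in no hypersurface of degree `u` as soon as `m ≥ (u + n).choose n`. -/
def HasGUP {n : ℕ} (Z : Set (ℙ ℂ (Fin (n + 1) → ℂ))) : Prop :=
  ∀ Z' : Finset (ℙ ℂ (Fin (n + 1) → ℂ)), (Z' : Set (ℙ ℂ (Fin (n + 1) → ℂ))) ⊆ Z →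
    ∀ u : ℕ, (u + n).choose n ≤ Z'.card →
      ¬ ∃ F : MvPolynomial (Fin (n + 1)) ℂ, F ≠ 0 ∧ F.IsHomogeneous u ∧ ∀ p ∈ Z', LiesOn p F

/-!
Two decompositions of `P` as a sum of `k` points of the Veronese variety, supported at sets of
points `A ≠ B` of the plane, give a relation `∑ c z * F(z) = 0` valid for all forms `F` of degree
`d`. Let `Z ⊆ A ∪ B` be the set of points where `c z ≠ 0`. It contains the symmetric difference of
`A` and `B`, so it is nonempty, and `|Z| ≤ 2 |Z ∩ A|`; also `|Z| ≤ 2k`. Such a relation is shown to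
be impossible (`not_exists_relation`).

Let `h(i)` be the dimension of the space of functions on `Z` cut out by forms of degree `i`. Forms
of degrees `i` and `d - i` are orthogonal for the nondegenerate bilinear form on functions on `Z`
with weights `c`, so `h(i) + h(d - i) ≤ |Z|` (`finrank_range_evalAt_add_le`). Let `e` be the least
degree of a curve `G = 0` containing `Z`. General uniform position of `A` gives
`|Z ∩ A| < (e + 2).choose 2`, hence `|Z| < (e + 1) (e + 2)`.

* If `d ≤ 2e`, then `h` takes its maximal value in degree about `d / 2`, and orthogonality
  contradicts the bound on `k`.
* If `d > 2e`, then all forms of degree `d + 1 - e` through `Z` are multiples of `G`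
  (`dvd_of_eval_eq_zero_of_minimal`), which determines `h(d + 1 - e)`. Orthogonality in the degrees
  `e - 1` and `d + 1 - e` gives `|Z| ≥ e (d + 3 - e) ≥ e (e + 4)`, contradicting the previous bound.

The statement on multiples of `G` is obtained by splitting off a greatest common divisor `H`: the
product of the relation with `H` is a relation in lower degree on the common zeros of two coprime
forms of small degrees. It is zero by a Cayley–Bacharach argument (`eq_empty_of_isRelPrime`), so
that `H` vanishes on `Z`, and minimality of `e` makes `H` proportional to `G`.
-/

open MvPolynomial

/-! ### Forms in three variables and their evaluation at points -/

/-- The substitution `X i ↦ X i * T` into polynomials in a new variable `T` multiplies a form of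
degree `n` by `T ^ n`. -/
theorem aeval_C_X_mul_X_of_isHomogeneous {σ R : Type*} [CommRing R] {F : MvPolynomial σ R} {n : ℕ}
    (hF : F.IsHomogeneous n) :
    aeval (fun i => Polynomial.C (X i : MvPolynomial σ R) * Polynomial.X) F =
      Polynomial.C F * Polynomial.X ^ n := by
  conv_lhs => rw [F.as_sum]
  conv_rhs => rw [F.as_sum]
  rw [map_sum, map_sum, Finset.sum_mul]
  refine Finset.sum_congr rfl fun s hs => ?_
  have hn : ∑ i ∈ s.support, s i = n := (hF.degree_eq_sum_deg_support hs).symm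
  rw [aeval_monomial, monomial_eq, ← hn]
  simp only [mul_pow, Finsupp.prod, Finset.prod_mul_distrib, Finset.prod_pow_eq_pow_sum]
  rw [← mul_assoc]
  simp only [map_mul, map_prod, map_pow, IsScalarTower.algebraMap_apply R (MvPolynomial σ R)
    (Polynomial (MvPolynomial σ R)), MvPolynomial.algebraMap_eq, Polynomial.algebraMap_eq]

theorem coeff_aeval_C_X_mul_X {σ R : Type*} [CommRing R] (F : MvPolynomial σ R) (n : ℕ) :
    (aeval (fun i => Polynomial.C (X i : MvPolynomial σ R) * Polynomial.X) F).coeff n =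
      homogeneousComponent n F := by
  conv_lhs => rw [← sum_homogeneousComponent F, map_sum]
  simp_rw [aeval_C_X_mul_X_of_isHomogeneous (homogeneousComponent_isHomogeneous _ F)]
  simp only [Polynomial.finsetSum_coeff, Polynomial.coeff_C_mul_X_pow]
  rw [Finset.sum_ite_eq, ite_eq_left_iff]
  intro h
  rw [homogeneousComponent_eq_zero]
  simpa using h

/-- A factor of a nonzero form is a form: after the substitution `X i ↦ X i * T` the product is a
monomial in `T`, and hence so are its factors. -/
theorem MvPolynomial.IsHomogeneous.of_mul_left {σ R : Type*} [CommRing R] [IsDomain R]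
    {F G : MvPolynomial σ R} {n : ℕ} (h : (F * G).IsHomogeneous n) (h0 : F * G ≠ 0) :
    F.IsHomogeneous F.totalDegree := by
  set Φ := MvPolynomial.aeval (R := R)
    (fun i => Polynomial.C (X i : MvPolynomial σ R) * Polynomial.X) with hΦ
  have h1 : Φ F * Φ G = Polynomial.C (F * G) * Polynomial.X ^ n := by
    rw [← map_mul, hΦ, aeval_C_X_mul_X_of_isHomogeneous h]
  have hne : Φ F * Φ G ≠ 0 := by
    rw [h1]; simpa using h0
  have hF := left_ne_zero_of_mul hne
  have hG := right_ne_zero_of_mul hne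
  have hd : (Φ F).natDegree + (Φ G).natDegree = n := by
    rw [← Polynomial.natDegree_mul hF hG, h1, Polynomial.natDegree_C_mul_X_pow _ _ h0]
  have ht : (Φ F).natTrailingDegree + (Φ G).natTrailingDegree = n := by
    rw [← Polynomial.natTrailingDegree_mul hF hG, h1, Polynomial.C_mul_X_pow_eq_monomial,
      Polynomial.natTrailingDegree_monomial h0]
  have h2 := Polynomial.natTrailingDegree_le_natDegree (Φ F)
  have h3 := Polynomial.natTrailingDegree_le_natDegree (Φ G)
  have key : ∀ m, m ≠ (Φ F).natDegree → homogeneousComponent m F = 0 := by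
    intro m hm
    rw [← coeff_aeval_C_X_mul_X]
    change (Φ F).coeff m = 0
    rcases lt_or_gt_of_ne hm with h4 | h4
    · exact Polynomial.coeff_eq_zero_of_lt_natTrailingDegree (by omega)
    · exact Polynomial.coeff_eq_zero_of_natDegree_lt h4
  have hh : F.IsHomogeneous (Φ F).natDegree := by
    have hs : (∑ i ∈ Finset.range (F.totalDegree + 1), homogeneousComponent i F).IsHomogeneous
        (Φ F).natDegree := by
      refine IsHomogeneous.sum _ _ _ fun i _ => ?_
      by_cases hi : i = (Φ F).natDegree
      · rw [hi]; exact homogeneousComponent_isHomogeneous _ _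
      · rw [key i hi]; exact isHomogeneous_zero _ _ _
    rwa [sum_homogeneousComponent] at hs
  rwa [hh.totalDegree (left_ne_zero_of_mul h0)]

theorem MvPolynomial.IsHomogeneous.exists_of_mul {σ R : Type*} [CommRing R] [IsDomain R]
    {F G : MvPolynomial σ R} {n : ℕ} (h : (F * G).IsHomogeneous n) (h0 : F * G ≠ 0) :
    ∃ i j, i + j = n ∧ F.IsHomogeneous i ∧ G.IsHomogeneous j := by
  have hF := h.of_mul_left h0
  have hG := (mul_comm F G ▸ h).of_mul_left (mul_comm F G ▸ h0)
  exact ⟨_, _, (hF.mul hG).inj_right h h0, hF, hG⟩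

/-- The space of ternary forms of degree `n`. -/
abbrev TernaryForm (n : ℕ) : Submodule ℂ (MvPolynomial (Fin 3) ℂ) :=
  homogeneousSubmodule (Fin 3) ℂ n

instance (n : ℕ) : FiniteDimensional ℂ (TernaryForm n) :=
  Module.Finite.of_fg (homogeneousSubmodule_fg (Fin 3) ℂ n)

theorem finrank_ternaryForm (n : ℕ) : Module.finrank ℂ (TernaryForm n) = (n + 2).choose 2 := by
  classical
  have hset : {d : Fin 3 →₀ ℕ | d.degree = n} =
      ↑(Finset.finsuppAntidiag (Finset.univ : Finset (Fin 3)) n) := by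
    ext d
    simp [Finset.mem_finsuppAntidiag, Finsupp.degree_eq_sum]
  have e : TernaryForm n ≃ₗ[ℂ] ({d : Fin 3 →₀ ℕ | d.degree = n} →₀ ℂ) :=
    (LinearEquiv.ofEq _ _ (homogeneousSubmodule_eq_finsupp_supported (Fin 3) ℂ n)).trans
      (AddMonoidAlgebra.supportedEquivFinsupp _)
  rw [e.finrank_eq, hset, Module.finrank_finsupp_self, ← Nat.card_eq_fintype_card,
    Nat.card_coe_set_eq, Set.ncard_coe_finset,
    Finset.card_finsuppAntidiag_nat_eq_choose, Finset.card_univ, Fintype.card_fin,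
    show 3 + n - 1 = n + 2 by omega, Nat.choose_symm_add]

/-- The linear form in three variables with the same values as a linear functional on `ℂ³`. -/
noncomputable def linearForm (f : Module.Dual ℂ (Fin 3 → ℂ)) : MvPolynomial (Fin 3) ℂ :=
  ∑ i, C (f (Pi.single i 1)) * X i

theorem isHomogeneous_linearForm (f : Module.Dual ℂ (Fin 3 → ℂ)) :
    (linearForm f).IsHomogeneous 1 :=
  IsHomogeneous.sum _ _ _ fun _ _ => isHomogeneous_C_mul_X _ _

@[simp]
theorem eval_linearForm (f : Module.Dual ℂ (Fin 3 → ℂ)) (v : Fin 3 → ℂ) :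
    eval v (linearForm f) = f v := by
  conv_rhs => rw [← Finset.univ_sum_single v, map_sum]
  simp only [linearForm, map_sum, map_mul, eval_C, eval_X]
  refine Finset.sum_congr rfl fun i _ => ?_
  rw [mul_comm, ← smul_eq_mul, ← map_smul]
  congr 1
  ext j
  simp [Pi.single_apply]

/-- A linear form vanishing at `q` may be chosen nonzero at finitely many given points other
than `q`. -/
theorem exists_dual_apply_eq_zero_of_finite {V : Set (ℙ ℂ (Fin 3 → ℂ))} (hV : V.Finite)
    (q : Fin 3 → ℂ) (hq : ∀ r ∈ V, r.rep ∉ Submodule.span ℂ {q}) :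
    ∃ f : Module.Dual ℂ (Fin 3 → ℂ), f q = 0 ∧ ∀ r ∈ V, f r.rep ≠ 0 := by
  have := hV.to_subtype
  obtain ⟨f, hf⟩ := Module.exists_dual_forall_apply_ne_zero (K := ℂ)
    (fun r : V => (Submodule.span ℂ {q}).mkQ r.1.rep)
    (fun r h => hq r.1 r.2 ((Submodule.Quotient.mk_eq_zero _).mp h))
  refine ⟨f ∘ₗ (Submodule.span ℂ {q}).mkQ, ?_, fun r hr => hf ⟨r, hr⟩⟩
  have : (Submodule.span ℂ {q}).mkQ q = 0 :=
    (Submodule.Quotient.mk_eq_zero _).mpr (Submodule.mem_span_singleton_self q)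
  simp [this]

theorem exists_dual_apply_ne_zero_of_finite {V : Set (ℙ ℂ (Fin 3 → ℂ))} (hV : V.Finite) :
    ∃ f : Module.Dual ℂ (Fin 3 → ℂ), ∀ r ∈ V, f r.rep ≠ 0 := by
  obtain ⟨f, -, hf⟩ := exists_dual_apply_eq_zero_of_finite hV 0 fun r _ h =>
    r.rep_nonzero (by simpa using h)
  exact ⟨f, hf⟩

theorem rep_notMem_span_rep {p q : ℙ ℂ (Fin 3 → ℂ)} (h : p ≠ q) :
    p.rep ∉ Submodule.span ℂ {q.rep} := by
  rw [Submodule.mem_span_singleton]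
  rintro ⟨t, ht⟩
  apply h
  rw [← p.mk_rep, ← q.mk_rep, Projectivization.mk_eq_mk_iff']
  exact ⟨t, ht⟩

/-- In degree at least `|Z| - 1`, there is a form vanishing at all points of `Z` but one. -/
theorem exists_isHomogeneous_eval_eq_zero {Z : Finset (ℙ ℂ (Fin 3 → ℂ))} {z : ℙ ℂ (Fin 3 → ℂ)}
    (hz : z ∈ Z) {n : ℕ} (hn : Z.card ≤ n + 1) :
    ∃ F : MvPolynomial (Fin 3) ℂ, F.IsHomogeneous n ∧ eval z.rep F ≠ 0 ∧
      ∀ w ∈ Z, w ≠ z → eval w.rep F = 0 := by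
  classical
  have h1 : ∀ w : ℙ ℂ (Fin 3 → ℂ), ∃ f : Module.Dual ℂ (Fin 3 → ℂ),
      f z.rep ≠ 0 ∧ (w ≠ z → f w.rep = 0) := by
    intro w
    by_cases hw : w = z
    · obtain ⟨f, hf⟩ := exists_dual_apply_ne_zero_of_finite (Set.finite_singleton z)
      exact ⟨f, hf z rfl, fun h => absurd hw h⟩
    · obtain ⟨f, hf0, hf⟩ := exists_dual_apply_eq_zero_of_finite (Set.finite_singleton z) w.rep
        (by rintro r rfl; exact rep_notMem_span_rep (Ne.symm hw))
      exact ⟨f, hf z rfl, fun _ => hf0⟩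
  choose f hfz hfw using h1
  have hcard := Finset.card_erase_of_mem hz
  refine ⟨(∏ w ∈ Z.erase z, linearForm (f w)) * linearForm (f z) ^ (n - (Z.erase z).card),
    ?_, ?_, ?_⟩
  · have := (IsHomogeneous.prod (Z.erase z) (fun w => linearForm (f w)) (fun _ => 1)
      fun w _ => isHomogeneous_linearForm _).mul
        ((isHomogeneous_linearForm (f z)).pow (n - (Z.erase z).card))
    convert this using 1
    simp only [Finset.sum_const, smul_eq_mul]
    omega
  · simp only [map_mul, map_prod, map_pow, eval_linearForm]
    exact mul_ne_zero (Finset.prod_ne_zero_iff.mpr fun w _ => hfz w) (pow_ne_zero _ (hfz z))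
  · intro w hw hne
    simp only [map_mul, map_prod, eval_linearForm]
    rw [Finset.prod_eq_zero (Finset.mem_erase.mpr ⟨hne, hw⟩) (hfw w hne), zero_mul]

/-- Evaluation of the forms of degree `n` at the chosen representatives of the points of `Z`. Its
rank is the value at `n` of the Hilbert function of `Z`. -/
noncomputable def evalAt (n : ℕ) (Z : Finset (ℙ ℂ (Fin 3 → ℂ))) :
    TernaryForm n →ₗ[ℂ] (Z → ℂ) where
  toFun F z := eval z.1.rep F.1
  map_add' F G := by ext z; simp
  map_smul' t F := by ext z; simp [smul_eval]

@[simp]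
theorem evalAt_apply (n : ℕ) (Z : Finset (ℙ ℂ (Fin 3 → ℂ))) (F : TernaryForm n) (z : Z) :
    evalAt n Z F z = eval z.1.rep F.1 := rfl

theorem mem_ker_evalAt {n : ℕ} {Z : Finset (ℙ ℂ (Fin 3 → ℂ))} {F : TernaryForm n} :
    F ∈ LinearMap.ker (evalAt n Z) ↔ ∀ z ∈ Z, eval z.rep F.1 = 0 := by
  simp [LinearMap.mem_ker, funext_iff]

theorem range_evalAt_eq_top {Z : Finset (ℙ ℂ (Fin 3 → ℂ))} {n : ℕ} (hn : Z.card ≤ n + 1) :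
    LinearMap.range (evalAt n Z) = ⊤ := by
  classical
  rw [eq_top_iff, ← (Pi.basisFun ℂ Z).span_eq, Submodule.span_le]
  rintro _ ⟨z, rfl⟩
  obtain ⟨F, hF, hFz, hFw⟩ := exists_isHomogeneous_eval_eq_zero z.2 hn
  refine ⟨(eval z.1.rep F)⁻¹ • ⟨F, hF⟩, ?_⟩
  ext w
  by_cases hw : w = z
  · subst hw; simp [hFz, smul_eval]
  · simp [smul_eval, hFw w.1 w.2 (fun h => hw (Subtype.ext h)), hw]

/-! ### Common zeros of coprime forms -/

theorem MvPolynomial.IsHomogeneous.of_mul_right {σ R : Type*} [CommRing R] [IsDomain R]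
    {F Q : MvPolynomial σ R} {a n : ℕ} (h : (F * Q).IsHomogeneous (a + n)) (hF : F.IsHomogeneous a)
    (hF0 : F ≠ 0) : Q.IsHomogeneous n := by
  by_cases hQ : Q = 0
  · rw [hQ]; exact isHomogeneous_zero _ _ _
  obtain ⟨i, j, hij, hi, hj⟩ := h.exists_of_mul (mul_ne_zero hF0 hQ)
  have := hi.inj_right hF hF0
  obtain rfl : j = n := by omega
  exact hj

/-- Multiplication by a form of degree `a`, from forms of degree `i` to forms of degree `a + i`. -/
noncomputable def mulForm {F : MvPolynomial (Fin 3) ℂ} {a : ℕ} (hF : F.IsHomogeneous a)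
    (i j : ℕ) (h : a + i = j) : TernaryForm i →ₗ[ℂ] TernaryForm j :=
  (LinearMap.mulLeft ℂ F).restrict fun _ hP => h ▸ hF.mul hP

@[simp]
theorem coe_mulForm {F : MvPolynomial (Fin 3) ℂ} {a : ℕ} (hF : F.IsHomogeneous a)
    (i j : ℕ) (h : a + i = j) (P : TernaryForm i) :
    (mulForm hF i j h P : MvPolynomial (Fin 3) ℂ) = F * P := rfl

theorem two_mul_choose_add_two (n : ℕ) : 2 * (n + 2).choose 2 = (n + 2) * (n + 1) := by
  rw [Nat.choose_two_right, Nat.mul_div_cancel' (Nat.even_mul_pred_self _).two_dvd]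
  rfl

/-- A weak form of Bézout's theorem: the Koszul complex of `F` and `G` gives the dimension of
the space of forms of large degree in the ideal `(F, G)`, all of which vanish on `Z`. -/
theorem card_le_mul_of_isRelPrime {F G : MvPolynomial (Fin 3) ℂ} {a b : ℕ}
    (hF : F.IsHomogeneous a) (hG : G.IsHomogeneous b) (hG0 : G ≠ 0)
    (hFG : IsRelPrime F G) {Z : Finset (ℙ ℂ (Fin 3 → ℂ))}
    (hZF : ∀ z ∈ Z, eval z.rep F = 0) (hZG : ∀ z ∈ Z, eval z.rep G = 0) : Z.card ≤ a * b := by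
  set m := Z.card with hm
  -- the Koszul complex `Q ↦ (G * Q, -F * Q)`, `(A, B) ↦ F * A + G * B` in degree `a + b + m`
  set κ := (mulForm hF (b + m) (a + b + m) (by ring)).coprod
    (mulForm hG (a + m) (a + b + m) (by ring)) with hκ
  set δ := (mulForm hG m (b + m) rfl).prod (-(mulForm hF m (a + m) rfl)) with hδ
  have h1 : LinearMap.range κ ≤ LinearMap.ker (evalAt (a + b + m) Z) := by
    rintro _ ⟨⟨A, B⟩, rfl⟩
    rw [mem_ker_evalAt]
    intro z hz
    simp [hκ, hZF z hz, hZG z hz]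
  have h2 : LinearMap.ker κ ≤ LinearMap.range δ := by
    rintro ⟨A, B⟩ hAB
    have hAB' : F * A.1 + G * B.1 = 0 := by
      have := congrArg Subtype.val (LinearMap.mem_ker.mp hAB)
      simpa [hκ] using this
    have hdvd : G ∣ F * A.1 := ⟨-B.1, by linear_combination hAB'⟩
    obtain ⟨Q, hQ⟩ := hFG.symm.dvd_of_dvd_mul_left hdvd
    have hQh : Q.IsHomogeneous m := by
      have := A.2
      rw [hQ] at this
      exact IsHomogeneous.of_mul_right this hG hG0
    have hB : B.1 = -(F * Q) := by
      apply mul_left_cancel₀ hG0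
      rw [hQ] at hAB'
      linear_combination hAB'
    refine ⟨⟨Q, hQh⟩, ?_⟩
    ext1 <;> apply Subtype.ext
    · simp [hδ, hQ]
    · simp [hδ, hB]
  have e1 := LinearMap.finrank_range_add_finrank_ker (evalAt (a + b + m) Z)
  have e2 := LinearMap.finrank_range_add_finrank_ker κ
  have e3 := Submodule.finrank_mono h1
  have e4 := (Submodule.finrank_mono h2).trans (LinearMap.finrank_range_le δ)
  rw [range_evalAt_eq_top (by omega), finrank_top] at e1
  simp only [Module.finrank_prod, finrank_ternaryForm, Module.finrank_fintype_fun_eq_card,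
    Fintype.card_coe, ← hm] at e1 e2 e4
  have c1 := two_mul_choose_add_two (a + b + m)
  have c2 := two_mul_choose_add_two (b + m)
  have c3 := two_mul_choose_add_two (a + m)
  have c4 := two_mul_choose_add_two m
  nlinarith

/-- Coprime forms have only finitely many common zeros in the plane. -/
theorem finite_zeros_of_isRelPrime {F G : MvPolynomial (Fin 3) ℂ} {a b : ℕ}
    (hF : F.IsHomogeneous a) (hG : G.IsHomogeneous b) (hG0 : G ≠ 0)
    (hFG : IsRelPrime F G) :
    {z : ℙ ℂ (Fin 3 → ℂ) | eval z.rep F = 0 ∧ eval z.rep G = 0}.Finite := by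
  by_contra h
  obtain ⟨Z, hZ, hc⟩ := Set.Infinite.exists_subset_card_eq h (a * b + 1)
  have := card_le_mul_of_isRelPrime hF hG hG0 hFG (fun z hz => (hZ hz).1)
    (fun z hz => (hZ hz).2)
  omega

/-- The restriction of a form of degree `n` to the affine line `t ↦ u + t v` has degree at most
`n`, and its coefficient of degree `n` is the value of the form at `v`. -/
theorem natDegree_aeval_le_and_coeff {σ : Type*} {F : MvPolynomial σ ℂ} {n : ℕ}
    (hF : F.IsHomogeneous n) (u v : σ → ℂ) :
    (aeval (fun i => Polynomial.C (u i) + Polynomial.C (v i) * Polynomial.X) F).natDegree ≤ n ∧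
    (aeval (fun i => Polynomial.C (u i) + Polynomial.C (v i) * Polynomial.X) F).coeff n =
      eval v F := by
  have hlin : ∀ i, (Polynomial.C (u i) + Polynomial.C (v i) * Polynomial.X).natDegree ≤ 1 := by
    intro i
    rw [add_comm]
    exact Polynomial.natDegree_linear_le
  have hpow : ∀ i (e : ℕ),
      ((Polynomial.C (u i) + Polynomial.C (v i) * Polynomial.X) ^ e).natDegree ≤ e ∧
      ((Polynomial.C (u i) + Polynomial.C (v i) * Polynomial.X) ^ e).coeff e = v i ^ e := by
    intro i e
    refine ⟨by simpa using Polynomial.natDegree_pow_le_of_le e (hlin i), ?_⟩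
    have := Polynomial.coeff_pow_of_natDegree_le (m := e) (hlin i)
    simpa using this
  have hprod : ∀ (s : σ →₀ ℕ) (T : Finset σ),
      (∏ i ∈ T, (Polynomial.C (u i) + Polynomial.C (v i) * Polynomial.X) ^ s i).natDegree ≤
        ∑ i ∈ T, s i ∧
      (∏ i ∈ T, (Polynomial.C (u i) + Polynomial.C (v i) * Polynomial.X) ^ s i).coeff
        (∑ i ∈ T, s i) = ∏ i ∈ T, v i ^ s i := by
    intro s T
    classical
    induction T using Finset.induction_on with
    | empty => simp
    | insert i T hi ih =>
      rw [Finset.prod_insert hi, Finset.sum_insert hi, Finset.prod_insert hi]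
      refine ⟨Polynomial.natDegree_mul_le_of_le (hpow i _).1 ih.1, ?_⟩
      rw [Polynomial.coeff_mul_add_eq_of_natDegree_le (hpow i _).1 ih.1, (hpow i _).2, ih.2]
  have hmon : ∀ s ∈ F.support,
      (aeval (fun i => Polynomial.C (u i) + Polynomial.C (v i) * Polynomial.X)
        (monomial s (coeff s F))).natDegree ≤ n ∧
      (aeval (fun i => Polynomial.C (u i) + Polynomial.C (v i) * Polynomial.X)
        (monomial s (coeff s F))).coeff n = eval v (monomial s (coeff s F)) := by
    intro s hs
    have hn : ∑ i ∈ s.support, s i = n := (hF.degree_eq_sum_deg_support hs).symm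
    obtain ⟨h1, h2⟩ := hprod s s.support
    rw [hn] at h1 h2
    rw [aeval_monomial, eval_monomial, Polynomial.algebraMap_eq, Finsupp.prod, Finsupp.prod,
      Polynomial.coeff_C_mul, h2]
    exact ⟨(Polynomial.natDegree_C_mul_le _ _).trans h1, rfl⟩
  constructor
  · conv_lhs => rw [F.as_sum]
    rw [map_sum]
    exact Polynomial.natDegree_sum_le_of_forall_le _ _ fun s hs => (hmon s hs).1
  · conv_lhs => rw [F.as_sum]
    conv_rhs => rw [F.as_sum]
    rw [map_sum, map_sum, Polynomial.finsetSum_coeff]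
    exact Finset.sum_congr rfl fun s hs => (hmon s hs).2

/-! ### Forms modulo two forms and a linear form -/

/-- Bézout's identity with a degree bound: coprime univariate polynomials of degrees `a` and at
most `b` generate every polynomial of degree at most `n`, with coefficients of the expected
degrees, as soon as `a + b ≤ n + 1`. -/
theorem exists_eq_mul_add_mul_of_isCoprime {f g r : Polynomial ℂ} {a b n i j : ℕ}
    (hfg : IsCoprime f g) (hf0 : f ≠ 0) (hf : f.natDegree = a) (hg : g.natDegree ≤ b)
    (hr : r.natDegree ≤ n) (hab : a + b ≤ n + 1) (hi : a + i = n) (hj : b + j = n) :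
    ∃ A B : Polynomial ℂ, A.natDegree ≤ i ∧ B.natDegree ≤ j ∧ r = A * f + B * g := by
  obtain ⟨u, v, huv⟩ := hfg
  have hmod := EuclideanDomain.div_add_mod (r * v) f
  have hlt : (r * v % f).degree < f.degree := EuclideanDomain.mod_lt _ hf0
  set B := r * v % f with hB
  set A := r * u + (r * v / f) * g with hA
  have hr' : r = A * f + B * g := by
    rw [hA]
    linear_combination (-r) * huv - g * hmod
  have hBg : (B * g).natDegree ≤ n := by
    by_cases hB0 : B = 0
    · simp [hB0]
    · have := Polynomial.natDegree_lt_natDegree hB0 hlt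
      have := Polynomial.natDegree_mul_le (p := B) (q := g)
      omega
  refine ⟨A, B, ?_, ?_, hr'⟩
  · by_cases hA0 : A = 0
    · simp [hA0]
    · have h1 : (A * f).natDegree ≤ n := by
        rw [show A * f = r - B * g by rw [hr']; ring]
        exact (Polynomial.natDegree_sub_le _ _).trans (max_le hr hBg)
      rw [Polynomial.natDegree_mul hA0 hf0] at h1
      omega
  · by_cases hB0 : B = 0
    · simp [hB0]
    · have := Polynomial.natDegree_lt_natDegree hB0 hlt
      omega

/-- Homogenization of a univariate polynomial with respect to two linear forms. -/
theorem exists_isHomogeneous_eval_eq (A : Polynomial ℂ) {m : ℕ} (hA : A.natDegree ≤ m)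
    (σ τ : Module.Dual ℂ (Fin 3 → ℂ)) :
    ∃ F : MvPolynomial (Fin 3) ℂ, F.IsHomogeneous m ∧
      ∀ v, σ v = 1 → eval v F = A.eval (τ v) := by
  refine ⟨∑ i ∈ Finset.range (m + 1),
    C (A.coeff i) * (linearForm σ ^ (m - i) * linearForm τ ^ i), ?_, ?_⟩
  · refine IsHomogeneous.sum _ _ _ fun i hi => ?_
    have hi' : i ≤ m := by simpa [Nat.lt_succ_iff] using hi
    have := ((isHomogeneous_linearForm σ).pow (m - i)).mul ((isHomogeneous_linearForm τ).pow i)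
    have h2 := this.C_mul (A.coeff i)
    convert h2 using 1
    omega
  · intro v hv
    rw [Polynomial.eval_eq_sum_range' (Nat.lt_succ_of_le hA)]
    simp [hv]

theorem MvPolynomial.IsHomogeneous.eval_smul_eq {σ R : Type*} [CommRing R] {F : MvPolynomial σ R}
    {n : ℕ} (hF : F.IsHomogeneous n) (t : R) (v : σ → R) :
    eval (t • v) F = t ^ n * eval v F := by
  rw [eval_eq, eval_eq, Finset.mul_sum]
  refine Finset.sum_congr rfl fun s hs => ?_
  have hn : ∑ i ∈ s.support, s i = n := (hF.degree_eq_sum_deg_support hs).symm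
  simp only [Pi.smul_apply, smul_eq_mul, mul_pow, Finset.prod_mul_distrib,
    Finset.prod_pow_eq_pow_sum, hn]
  ring

/-- A form vanishing on the affine line `σ = 1`, `ℓ = 0` is a multiple of `ℓ`. Here `σ` and `ℓ`
are coordinates with respect to a basis. -/
theorem linearForm_dvd_of_eval_eq_zero (B : Module.Basis (Fin 3) ℂ (Fin 3 → ℂ))
    {D : MvPolynomial (Fin 3) ℂ} {n : ℕ} (hD : D.IsHomogeneous n)
    (h : ∀ v, B.coord 0 v = 1 → B.coord 2 v = 0 → eval v D = 0) :
    linearForm (B.coord 2) ∣ D := by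
  -- `ψ` is the substitution induced by the projection onto the plane `ℓ = 0` along `B 2`
  set ψ : MvPolynomial (Fin 3) ℂ →ₐ[ℂ] MvPolynomial (Fin 3) ℂ :=
    aeval (fun i => C (B 0 i) * linearForm (B.coord 0) + C (B 1 i) * linearForm (B.coord 1)) with hψ
  have heval : ∀ v P, eval v (ψ P) = eval (B.coord 0 v • B 0 + B.coord 1 v • B 1) P := by
    intro v P
    have : (aeval (R := ℂ) v).comp ψ =
        aeval (R := ℂ) (B.coord 0 v • B 0 + B.coord 1 v • B 1) := by
      apply algHom_ext
      intro i
      simp [hψ, aeval_eq_eval, mul_comm]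
    have h2 := DFunLike.congr_fun this P
    simpa [aeval_eq_eval] using h2
  have hcoord : ∀ v, v = B.coord 0 v • B 0 + B.coord 1 v • B 1 + B.coord 2 v • B 2 := by
    intro v
    have := (B.sum_repr v).symm
    rwa [Fin.sum_univ_three] at this
  -- off the line `B.coord 0 = 0` this is the hypothesis, up to scaling
  have hψD : ψ D = 0 := by
    have hmul : ψ D * linearForm (B.coord 0) = 0 := by
      apply MvPolynomial.funext
      intro v
      rw [map_mul, eval_linearForm, map_zero, heval]
      by_cases hv : B.coord 0 v = 0
      · rw [hv, mul_zero]
      · have h1 : B.coord 0 v • B 0 + B.coord 1 v • B 1 =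
            B.coord 0 v • (B 0 + ((B.coord 0 v)⁻¹ * B.coord 1 v) • B 1) := by
          rw [smul_add, smul_smul, mul_inv_cancel_left₀ hv]
        rw [h1, hD.eval_smul_eq, h _ (by simp) (by simp)]
        simp
    refine (mul_eq_zero.mp hmul).resolve_right fun h0 => ?_
    have := congrArg (eval (B 0)) h0
    simp at this
  have hmk : (Ideal.Quotient.mkₐ ℂ (Ideal.span {linearForm (B.coord 2)})).comp ψ =
      Ideal.Quotient.mkₐ ℂ (Ideal.span {linearForm (B.coord 2)}) := by
    apply algHom_ext
    intro i
    simp only [AlgHom.comp_apply, hψ, aeval_X, Ideal.Quotient.mkₐ_eq_mk]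
    rw [Ideal.Quotient.eq, Ideal.mem_span_singleton]
    refine ⟨-C (B 2 i), MvPolynomial.funext fun v => ?_⟩
    have := congrFun (hcoord v) i
    simp only [Pi.add_apply, Pi.smul_apply, smul_eq_mul] at this
    simp only [map_sub, map_add, map_mul, map_neg, eval_C, eval_X, eval_linearForm]
    linear_combination -this
  have := DFunLike.congr_fun hmk D
  rw [AlgHom.comp_apply, hψD, map_zero] at this
  exact Ideal.mem_span_singleton.mp (Ideal.Quotient.eq_zero_iff_mem.mp this.symm)

/-- If the line with equation `ℓ = 0` contains no common zero of `F` and `G`, then every form of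
degree at least `a + b - 1` lies in the ideal `(F, G, ℓ)`. -/
theorem exists_eq_add_add_linearForm_mul (B : Module.Basis (Fin 3) ℂ (Fin 3 → ℂ))
    {F G Q : MvPolynomial (Fin 3) ℂ} {a b n : ℕ} (hF : F.IsHomogeneous a) (hG : G.IsHomogeneous b)
    (hFB : eval (B 1) F ≠ 0)
    (hFG : ∀ v, v ≠ 0 → B.coord 2 v = 0 → eval v F = 0 → eval v G ≠ 0)
    (hQ : Q.IsHomogeneous (n + 1)) (hab : a + b ≤ n + 2) (ha : a ≤ n + 1) (hb : b ≤ n + 1) :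
    ∃ U V W : MvPolynomial (Fin 3) ℂ, W.IsHomogeneous n ∧
      Q = U * F + V * G + linearForm (B.coord 2) * W := by
  -- `ρ` is the restriction to the affine line `t ↦ B 0 + t • B 1`
  set ρ : MvPolynomial (Fin 3) ℂ →ₐ[ℂ] Polynomial ℂ :=
    aeval (fun i => Polynomial.C (B 0 i) + Polynomial.C (B 1 i) * Polynomial.X) with hρ
  have hρe : ∀ P t, (ρ P).eval t = eval (B 0 + t • B 1) P := by
    intro P t
    have : (Polynomial.aeval (R := ℂ) t).comp ρ = aeval (R := ℂ) (B 0 + t • B 1) := by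
      apply algHom_ext
      intro i
      simp only [hρ, AlgHom.comp_apply, aeval_X, map_add, map_mul, Polynomial.aeval_C,
        Polynomial.aeval_X, Pi.add_apply, Pi.smul_apply, smul_eq_mul, Algebra.algebraMap_self,
        RingHom.id_apply]
      ring
    have h2 := DFunLike.congr_fun this P
    simpa [aeval_eq_eval, Polynomial.coe_aeval_eq_eval] using h2
  obtain ⟨hf1, hf2⟩ := natDegree_aeval_le_and_coeff hF (B 0) (B 1)
  have hg := (natDegree_aeval_le_and_coeff hG (B 0) (B 1)).1
  have hq := (natDegree_aeval_le_and_coeff hQ (B 0) (B 1)).1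
  rw [← hρ] at hf1 hf2 hg hq
  have hf0 : ρ F ≠ 0 := by
    intro h0
    rw [h0, Polynomial.coeff_zero] at hf2
    exact hFB hf2.symm
  have hfd : (ρ F).natDegree = a :=
    le_antisymm hf1 (Polynomial.le_natDegree_of_ne_zero (hf2 ▸ hFB))
  have hcop : IsCoprime (ρ F) (ρ G) := by
    rw [Polynomial.isCoprime_iff_aeval_ne_zero_of_isAlgClosed ℂ ℂ]
    intro t
    simp only [Polynomial.coe_aeval_eq_eval, hρe]
    by_contra! hc
    refine hFG (B 0 + t • B 1) (fun h0 => ?_) (by simp) hc.1 hc.2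
    have := congrArg (B.coord 0) h0
    simp at this
  obtain ⟨u, v, hu, hv, huv⟩ := exists_eq_mul_add_mul_of_isCoprime hcop hf0 hfd hg hq
    (by omega) (Nat.add_sub_of_le ha) (Nat.add_sub_of_le hb)
  obtain ⟨U, hU, hUe⟩ := exists_isHomogeneous_eval_eq u hu (B.coord 0) (B.coord 1)
  obtain ⟨V, hV, hVe⟩ := exists_isHomogeneous_eval_eq v hv (B.coord 0) (B.coord 1)
  have hUF : (U * F).IsHomogeneous (n + 1) := by
    have := hU.mul hF
    rwa [Nat.sub_add_cancel ha] at this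
  have hVG : (V * G).IsHomogeneous (n + 1) := by
    have := hV.mul hG
    rwa [Nat.sub_add_cancel hb] at this
  have hD : (Q - U * F - V * G).IsHomogeneous (n + 1) := (hQ.sub hUF).sub hVG
  obtain ⟨W, hW⟩ := linearForm_dvd_of_eval_eq_zero B hD (by
    intro w hw0 hw2
    have hw : w = B 0 + B.coord 1 w • B 1 := by
      have h0 : B.repr w 0 = 1 := hw0
      have h2 : B.repr w 2 = 0 := hw2
      have := (B.sum_repr w).symm
      rwa [Fin.sum_univ_three, h0, h2, one_smul, zero_smul, add_zero] at this
    have h1 := congrArg (Polynomial.eval (B.coord 1 w)) huv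
    rw [Polynomial.eval_add, Polynomial.eval_mul, Polynomial.eval_mul, ← hUe w hw0, ← hVe w hw0,
      hρe, hρe, hρe, ← hw] at h1
    simp only [map_sub, map_mul]
    linear_combination h1)
  have hl0 : linearForm (B.coord 2) ≠ 0 := by
    intro h0
    have := congrArg (eval (B 2)) h0
    simp at this
  refine ⟨U, V, W, ?_, by rw [← hW]; ring⟩
  rw [hW, add_comm] at hD
  exact hD.of_mul_right (isHomogeneous_linearForm _) hl0

/-! ### Relations between evaluations at points -/

/-- A point of a line in the plane and the equation of the line are part of a system of
coordinates. -/
theorem exists_basis_coord_eq_zero_iff {f : Module.Dual ℂ (Fin 3 → ℂ)} {q : Fin 3 → ℂ} (hf : f ≠ 0)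
    (hq : q ≠ 0) (hfq : f q = 0) :
    ∃ B : Module.Basis (Fin 3) ℂ (Fin 3 → ℂ), B 1 = q ∧ ∀ v, B.coord 2 v = 0 ↔ f v = 0 := by
  obtain ⟨p, hp, hpq⟩ : ∃ p ∈ LinearMap.ker f, p ∉ Submodule.span ℂ {q} := by
    by_contra! h
    have h1 := Submodule.finrank_mono (show LinearMap.ker f ≤ Submodule.span ℂ {q} from h)
    rw [finrank_span_singleton hq] at h1
    have h2 := LinearMap.finrank_range_add_finrank_ker f
    have h3 := Submodule.finrank_le (LinearMap.range f)
    simp only [Module.finrank_self, Module.finrank_fintype_fun_eq_card, Fintype.card_fin] at h2 h3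
    omega
  obtain ⟨r, hr⟩ : ∃ r, f r ≠ 0 := by
    by_contra! h
    exact hf (LinearMap.ext h)
  rw [LinearMap.mem_ker] at hp
  have hli : LinearIndependent ℂ ![p, q, r] := by
    rw [Fintype.linearIndependent_iff]
    intro g hg
    simp only [Fin.sum_univ_three, Matrix.cons_val] at hg
    have h2 : g 2 = 0 := by
      have := congrArg f hg
      simpa [hp, hfq, hr] using this
    rw [h2, zero_smul, add_zero] at hg
    have h0 : g 0 = 0 := by
      by_contra h0
      refine hpq (Submodule.mem_span_singleton.mpr ⟨-((g 0)⁻¹ * g 1), ?_⟩)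
      have := congrArg (fun v => (g 0)⁻¹ • v) hg
      simp only [smul_add, smul_smul, inv_mul_cancel₀ h0, one_smul, smul_zero] at this
      rw [neg_smul]
      exact (eq_neg_of_add_eq_zero_left this).symm
    rw [h0, zero_smul, zero_add, smul_eq_zero_iff_left hq] at hg
    intro i
    fin_cases i <;> assumption
  set B := basisOfLinearIndependentOfCardEqFinrank hli (by simp) with hB
  have hB' : ∀ i, B i = ![p, q, r] i := fun i => by rw [hB]; simp
  refine ⟨B, by simp [hB'], fun v => ?_⟩
  have h1 := congrArg f (B.sum_repr v)
  rw [Fin.sum_univ_three] at h1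
  simp only [hB', Matrix.cons_val, map_add, map_smul, hp, hfq, smul_zero, zero_add] at h1
  rw [← h1, smul_eq_mul, mul_eq_zero]
  simp [hr]

theorem eval_rep_mk_eq_zero_iff {F : MvPolynomial (Fin 3) ℂ} {n : ℕ} (hF : F.IsHomogeneous n)
    {v : Fin 3 → ℂ} (hv : v ≠ 0) :
    eval (Projectivization.mk ℂ v hv).rep F = 0 ↔ eval v F = 0 := by
  obtain ⟨t, ht⟩ := Projectivization.exists_smul_eq_mk_rep ℂ v hv
  rw [← ht, Units.smul_def, hF.eval_smul_eq]
  simp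

/-- A relation with nonzero coefficients between the evaluations of the forms of degree `n` at
points of a set `Z` contained in the common zeros of two coprime forms of degrees `a` and `b`
forces `a + b ≥ n + 3`, unless `Z` is empty. This is the Cayley–Bacharach phenomenon: on a line
`ℓ` without common zeros of `F` and `G`, these generate all forms of large degree, and so dividing
the coefficients by powers of `ℓ` extends the relation to forms of any degree. -/
theorem eq_empty_of_isRelPrime {F G : MvPolynomial (Fin 3) ℂ} {a b n : ℕ}
    (hF : F.IsHomogeneous a) (hG : G.IsHomogeneous b) (hF0 : F ≠ 0) (hG0 : G ≠ 0)
    (hFG : IsRelPrime F G) {Z : Finset (ℙ ℂ (Fin 3 → ℂ))} {c : ℙ ℂ (Fin 3 → ℂ) → ℂ}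
    (hZF : ∀ z ∈ Z, eval z.rep F = 0) (hZG : ∀ z ∈ Z, eval z.rep G = 0)
    (hc : ∀ z ∈ Z, c z ≠ 0)
    (hrel : ∀ Q : MvPolynomial (Fin 3) ℂ, Q.IsHomogeneous n → ∑ z ∈ Z, c z * eval z.rep Q = 0)
    (hab : a + b ≤ n + 2) (ha : a ≤ n + 1) (hb : b ≤ n + 1) : Z = ∅ := by
  by_contra hne
  obtain ⟨z, hz⟩ := Finset.nonempty_of_ne_empty hne
  set V := {z : ℙ ℂ (Fin 3 → ℂ) | eval z.rep F = 0 ∧ eval z.rep G = 0} with hV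
  have hVfin : V.Finite := finite_zeros_of_isRelPrime hF hG hG0 hFG
  have hZV : ∀ z ∈ Z, z ∈ V := fun z hz => ⟨hZF z hz, hZG z hz⟩
  -- `q` will be the point at infinity of the line `ℓ`; the factor `X 0` ensures `q ≠ 0`
  obtain ⟨q, hq0, hq⟩ : ∃ q : Fin 3 → ℂ, q ≠ 0 ∧ eval q F ≠ 0 := by
    by_contra! h
    have h0 : F * X 0 = 0 := by
      apply MvPolynomial.funext
      intro v
      by_cases hv : v = 0
      · simp [hv]
      · simp [h v hv]
    exact (mul_ne_zero hF0 (X_ne_zero 0)) h0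
  obtain ⟨f, hfq, hfV⟩ := exists_dual_apply_eq_zero_of_finite hVfin q (by
    intro r hr hrq
    obtain ⟨t, ht⟩ := Submodule.mem_span_singleton.mp hrq
    have h0 := hr.1
    rw [← ht, hF.eval_smul_eq] at h0
    have ht0 : t ≠ 0 := by
      rintro rfl
      exact r.rep_nonzero (by simpa using ht.symm)
    exact mul_ne_zero (pow_ne_zero _ ht0) hq h0)
  obtain ⟨B, hBq, hBf⟩ := exists_basis_coord_eq_zero_iff
    (fun h => hfV z (hZV z hz) (by simp [h])) hq0 hfq
  have hBZ : ∀ z ∈ Z, B.coord 2 z.rep ≠ 0 := fun z hz h => hfV z (hZV z hz) ((hBf _).mp h)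
  have hline : ∀ v, v ≠ 0 → B.coord 2 v = 0 → eval v F = 0 → eval v G ≠ 0 := by
    intro v hv hv2 hvF hvG
    refine hfV (Projectivization.mk ℂ v hv)
      ⟨(eval_rep_mk_eq_zero_iff hF hv).mpr hvF, (eval_rep_mk_eq_zero_iff hG hv).mpr hvG⟩ ?_
    obtain ⟨t, ht⟩ := Projectivization.exists_smul_eq_mk_rep ℂ v hv
    rw [← ht, Units.smul_def, map_smul, (hBf v).mp hv2, smul_zero]
  have key : ∀ s : ℕ, ∀ Q : MvPolynomial (Fin 3) ℂ, Q.IsHomogeneous (n + s) →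
      ∑ z ∈ Z, c z * (B.coord 2 z.rep)⁻¹ ^ s * eval z.rep Q = 0 := by
    intro s
    induction s with
    | zero => simpa using hrel
    | succ s ih =>
      intro Q hQ
      obtain ⟨U, V', W, hW, rfl⟩ := exists_eq_add_add_linearForm_mul B hF hG (hBq ▸ hq) hline
        (n := n + s) hQ (by omega) (by omega) (by omega)
      rw [← ih W hW]
      refine Finset.sum_congr rfl fun w hw => ?_
      simp only [map_add, map_mul, hZF w hw, hZG w hw, eval_linearForm, mul_zero, zero_add]
      rw [pow_succ]
      linear_combination c w * (B.coord 2 w.rep)⁻¹ ^ s * eval w.rep W * inv_mul_cancel₀ (hBZ w hw)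
  obtain ⟨Q, hQ, hQz, hQw⟩ := exists_isHomogeneous_eval_eq_zero hz
    (show Z.card ≤ (n + Z.card) + 1 by omega)
  have h := key Z.card Q hQ
  rw [Finset.sum_eq_single_of_mem z hz (fun w hw hwz => by rw [hQw w hw hwz, mul_zero])] at h
  exact mul_ne_zero (mul_ne_zero (hc z hz) (pow_ne_zero _ (inv_ne_zero (hBZ z hz)))) hQz h

/-- If `G` is a form of minimal degree `e` vanishing on `Z`, and `Z` supports a relation in
degree `d`, then all forms of degree at most `d + 1 - e` vanishing on `Z` are multiples of `G`. -/
theorem dvd_of_eval_eq_zero_of_minimal {F G : MvPolynomial (Fin 3) ℂ} {e j d : ℕ}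
    {Z : Finset (ℙ ℂ (Fin 3 → ℂ))} {c : ℙ ℂ (Fin 3 → ℂ) → ℂ}
    (hc : ∀ z ∈ Z, c z ≠ 0)
    (hrel : ∀ Q : MvPolynomial (Fin 3) ℂ, Q.IsHomogeneous d → ∑ z ∈ Z, c z * eval z.rep Q = 0)
    (hG : G.IsHomogeneous e) (hG0 : G ≠ 0) (hZG : ∀ z ∈ Z, eval z.rep G = 0)
    (hmin : ∀ i, ∀ P : MvPolynomial (Fin 3) ℂ, P ≠ 0 → P.IsHomogeneous i →
      (∀ z ∈ Z, eval z.rep P = 0) → e ≤ i)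
    (hF : F.IsHomogeneous j) (hZF : ∀ z ∈ Z, eval z.rep F = 0) (hej : e + j ≤ d + 1) : G ∣ F := by
  by_cases hF0 : F = 0
  · rw [hF0]; exact dvd_zero _
  have hle := hmin j F hF0 hF hZF
  obtain ⟨G', F', H, hrp, rfl, rfl⟩ :=
    UniqueFactorizationMonoid.exists_reduced_factors G hG0 F
  obtain ⟨h, g, hhg, hH, hG'⟩ := hG.exists_of_mul hG0
  obtain ⟨h', f, hhf, hH', hF'⟩ := hF.exists_of_mul hF0
  have hH0 := left_ne_zero_of_mul hG0
  have hG'0 := right_ne_zero_of_mul hG0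
  have hF'0 := right_ne_zero_of_mul hF0
  obtain rfl := hH.inj_right hH' hH0
  have hempty : Z.filter (fun z => eval z.rep H ≠ 0) = ∅ := by
    refine eq_empty_of_isRelPrime (n := d - h) (c := fun z => c z * eval z.rep H) hG' hF' hG'0 hF'0
      hrp ?_ ?_ ?_ ?_ (by omega) (by omega) (by omega)
    · intro z hz
      rw [Finset.mem_filter] at hz
      have := hZG z hz.1
      rw [map_mul] at this
      exact (mul_eq_zero.mp this).resolve_left hz.2
    · intro z hz
      rw [Finset.mem_filter] at hz
      have := hZF z hz.1
      rw [map_mul] at this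
      exact (mul_eq_zero.mp this).resolve_left hz.2
    · intro z hz
      rw [Finset.mem_filter] at hz
      exact mul_ne_zero (hc z hz.1) hz.2
    · intro Q hQ
      have hHQ := hH.mul hQ
      rw [show h + (d - h) = d by omega] at hHQ
      refine Eq.trans ?_ (hrel _ hHQ)
      rw [Finset.sum_filter_of_ne]
      · exact Finset.sum_congr rfl fun z _ => by rw [map_mul]; ring
      · intro z _ hz h0
        simp [h0] at hz
  have hHZ : ∀ z ∈ Z, eval z.rep H = 0 := by
    intro z hz
    by_contra h0
    exact Finset.notMem_empty z (hempty ▸ Finset.mem_filter.mpr ⟨hz, h0⟩)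
  have hg0 : g = 0 := by
    have := hmin h H hH0 hH hHZ
    omega
  subst hg0
  have hGC := (totalDegree_eq_zero_iff_eq_C).mp (Nat.le_zero.mp hG'.totalDegree_le)
  refine mul_dvd_mul_left H (IsUnit.dvd ?_)
  rw [hGC] at hG'0 ⊢
  exact (isUnit_iff_ne_zero.mpr fun h => hG'0 (by rw [h, map_zero])).map C

/-- Forms of degrees `i` and `j` restrict to orthogonal spaces of functions on `Z` for the
nondegenerate bilinear form whose coefficients are those of a relation in degree `i + j`. -/
theorem finrank_range_evalAt_add_le {i j d : ℕ} {Z : Finset (ℙ ℂ (Fin 3 → ℂ))}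
    {c : ℙ ℂ (Fin 3 → ℂ) → ℂ} (hc : ∀ z ∈ Z, c z ≠ 0)
    (hrel : ∀ Q : MvPolynomial (Fin 3) ℂ, Q.IsHomogeneous d → ∑ z ∈ Z, c z * eval z.rep Q = 0)
    (hij : i + j = d) :
    Module.finrank ℂ (LinearMap.range (evalAt i Z)) +
      Module.finrank ℂ (LinearMap.range (evalAt j Z)) ≤ Z.card := by
  classical
  set T : (Z → ℂ) →ₗ[ℂ] Module.Dual ℂ (Z → ℂ) :=
    LinearMap.mk₂ ℂ (fun f g => ∑ z : Z, c z * f z * g z)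
      (fun f f' g => by simp [mul_add, add_mul, Finset.sum_add_distrib])
      (fun t f g => by simp only [Pi.smul_apply, smul_eq_mul, Finset.mul_sum]; congr! 1; ring)
      (fun f g g' => by simp [mul_add, Finset.sum_add_distrib])
      (fun t f g => by simp only [Pi.smul_apply, smul_eq_mul, Finset.mul_sum]; congr! 1; ring)
    with hT
  have hinj : Function.Injective T := by
    rw [← LinearMap.ker_eq_bot, LinearMap.ker_eq_bot']
    intro f hf
    ext z
    have := DFunLike.congr_fun hf (Pi.single z 1)
    simpa [hT, Pi.single_apply, hc z.1 z.2] using this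
  have hle : (LinearMap.range (evalAt j Z)).map T ≤
      (LinearMap.range (evalAt i Z)).dualAnnihilator := by
    rintro _ ⟨_, ⟨P, rfl⟩, rfl⟩
    rw [Submodule.mem_dualAnnihilator]
    rintro _ ⟨Q, rfl⟩
    have := hrel (P.1 * Q.1) (by rw [← hij, add_comm]; exact IsHomogeneous.mul P.2 Q.2)
    rw [← Finset.sum_coe_sort] at this
    simpa [hT, mul_assoc] using this
  have h1 := Submodule.finrank_mono hle
  rw [← (Submodule.equivMapOfInjective T hinj _).finrank_eq] at h1
  have h2 := Subspace.finrank_add_finrank_dualAnnihilator_eq (LinearMap.range (evalAt i Z))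
  simp only [Module.finrank_fintype_fun_eq_card, Fintype.card_coe] at h2
  omega

/-- The Hilbert function of a finite set of points is nondecreasing. -/
theorem finrank_range_evalAt_mono (Z : Finset (ℙ ℂ (Fin 3 → ℂ))) {i j : ℕ} (hij : i ≤ j) :
    Module.finrank ℂ (LinearMap.range (evalAt i Z)) ≤
      Module.finrank ℂ (LinearMap.range (evalAt j Z)) := by
  obtain ⟨f, hf⟩ := exists_dual_apply_ne_zero_of_finite Z.finite_toSet
  set T : (Z → ℂ) →ₗ[ℂ] (Z → ℂ) := LinearMap.mulLeft ℂ fun z => f z.1.rep ^ (j - i) with hT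
  have hinj : Function.Injective T := by
    intro g g' h
    ext z
    have := congrFun h z
    simpa [hT, hf z.1 z.2] using this
  have hle : (LinearMap.range (evalAt i Z)).map T ≤ LinearMap.range (evalAt j Z) := by
    rintro _ ⟨_, ⟨P, rfl⟩, rfl⟩
    have hP := ((isHomogeneous_linearForm f).pow (j - i)).mul P.2
    rw [one_mul, Nat.sub_add_cancel hij] at hP
    refine ⟨⟨_, hP⟩, ?_⟩
    ext z
    simp [hT]
  rw [(Submodule.equivMapOfInjective T hinj _).finrank_eq]
  exact Submodule.finrank_mono hle

/-- A relation in degree `d` with support `Z` cannot exist if `|Z|` is small and at least half of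
the points of `Z` are in general uniform position. The hypothesis `hgup` says that
the points of `T` are. -/
theorem not_exists_relation {d : ℕ} {Z T : Finset (ℙ ℂ (Fin 3 → ℂ))}
    {c : ℙ ℂ (Fin 3 → ℂ) → ℂ} (hZ : Z.Nonempty) (hc : ∀ z ∈ Z, c z ≠ 0)
    (hrel : ∀ Q : MvPolynomial (Fin 3) ℂ, Q.IsHomogeneous d → ∑ z ∈ Z, c z * eval z.rep Q = 0)
    (hTZ : T ⊆ Z) (hT : Z.card ≤ 2 * T.card)
    (hgup : ∀ (u : ℕ) (F : MvPolynomial (Fin 3) ℂ), F ≠ 0 → F.IsHomogeneous u →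
      (∀ z ∈ T, eval z.rep F = 0) → T.card < (u + 2).choose 2)
    (hd : 4 * Z.card < d ^ 2 + 2 * d) : False := by
  classical
  have hex : ∃ e, ∃ G : MvPolynomial (Fin 3) ℂ, G ≠ 0 ∧ G.IsHomogeneous e ∧
      ∀ z ∈ Z, eval z.rep G = 0 := by
    -- there are more forms of degree `|Z|` than conditions
    have hlt : Module.finrank ℂ (Z → ℂ) < Module.finrank ℂ (TernaryForm Z.card) := by
      rw [finrank_ternaryForm, Module.finrank_fintype_fun_eq_card, Fintype.card_coe]
      nlinarith [two_mul_choose_add_two Z.card]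
    obtain ⟨G, hG, hG0⟩ := Submodule.exists_mem_ne_zero_of_ne_bot
      (LinearMap.ker_ne_bot_of_finrank_lt (f := evalAt Z.card Z) hlt)
    exact ⟨_, G.1, fun h => hG0 (Subtype.ext h), G.2, mem_ker_evalAt.mp hG⟩
  obtain ⟨G, hG0, hG, hZG⟩ := Nat.find_spec hex
  have hmin : ∀ i, ∀ P : MvPolynomial (Fin 3) ℂ, P ≠ 0 → P.IsHomogeneous i →
      (∀ z ∈ Z, eval z.rep P = 0) → Nat.find hex ≤ i :=
    fun i P hP0 hP hPZ => Nat.find_min' hex ⟨P, hP0, hP, hPZ⟩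
  generalize Nat.find hex = e at hG hmin
  have hTe := hgup e G hG0 hG fun z hz => hZG z (hTZ hz)
  have hfull : ∀ i, i < e →
      Module.finrank ℂ (LinearMap.range (evalAt i Z)) = (i + 2).choose 2 := by
    intro i hi
    rw [LinearMap.finrank_range_of_inj, finrank_ternaryForm]
    rw [← LinearMap.ker_eq_bot, LinearMap.ker_eq_bot']
    intro P hP
    by_contra hP0
    have := hmin i P.1 (fun h => hP0 (Subtype.ext h)) P.2 (mem_ker_evalAt.mp hP)
    omega
  have he0 : e ≠ 0 := by
    rintro rfl
    have hGC := (totalDegree_eq_zero_iff_eq_C).mp (Nat.le_zero.mp hG.totalDegree_le)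
    obtain ⟨z, hz⟩ := hZ
    have h1 := hZG z hz
    rw [hGC, eval_C] at h1
    rw [h1, map_zero] at hGC
    exact hG0 hGC
  obtain ⟨i, rfl⟩ := Nat.exists_eq_succ_of_ne_zero he0
  rcases le_or_gt d (2 * (i + 1)) with hde | hde
  · -- `Z` lies on no curve of degree `m`, where `2 * m + 2` is `d` or `d + 1`
    obtain ⟨m, hm⟩ : ∃ m, d = 2 * m + 2 ∨ d = 2 * m + 1 := by
      have : d ≠ 0 := by rintro rfl; omega
      exact ⟨(d - 1) / 2, by omega⟩
    have h1 := finrank_range_evalAt_add_le (i := m) (j := d - m) hc hrel (by omega)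
    have h2 := finrank_range_evalAt_mono Z (show m ≤ d - m by omega)
    rw [hfull m (by omega)] at h1 h2
    have h3 := two_mul_choose_add_two m
    rcases hm with rfl | rfl <;> nlinarith
  · -- the forms of degree `j` vanishing on `Z` are the multiples of `G`
    obtain ⟨j, rfl⟩ : ∃ j, d = i + j := ⟨d - i, by omega⟩
    obtain ⟨t, rfl⟩ : ∃ t, j = i + 1 + t := ⟨j - (i + 1), by omega⟩
    have h1 := finrank_range_evalAt_add_le hc hrel (i := i) rfl
    have h2 := LinearMap.finrank_range_add_finrank_ker (evalAt (i + 1 + t) Z)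
    have h3 : LinearMap.ker (evalAt (i + 1 + t) Z) ≤
        LinearMap.range (mulForm hG t (i + 1 + t) rfl) := by
      intro F hF
      obtain ⟨Q, hQ⟩ := dvd_of_eval_eq_zero_of_minimal hc hrel hG hG0 hZG hmin F.2
        (mem_ker_evalAt.mp hF) (by omega)
      have hQh : Q.IsHomogeneous t := by
        have := F.2
        rw [hQ] at this
        exact IsHomogeneous.of_mul_right this hG hG0
      exact ⟨⟨Q, hQh⟩, Subtype.ext hQ.symm⟩
    have h4 := (Submodule.finrank_mono h3).trans (LinearMap.finrank_range_le _)
    rw [hfull i (by omega)] at h1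
    rw [finrank_ternaryForm] at h2 h4
    have c1 := two_mul_choose_add_two i
    have c2 := two_mul_choose_add_two (i + 1 + t)
    have c3 := two_mul_choose_add_two t
    have c4 := two_mul_choose_add_two (i + 1)
    simp only [Nat.succ_eq_add_one] at hTe
    obtain ⟨s, rfl⟩ : ∃ s, t = s + 2 := ⟨t - 2, by omega⟩
    have his : 0 ≤ i * s := Nat.zero_le _
    nlinarith

/-! ### Decompositions of points of the Veronese space -/

theorem veronese_eq_mk (n d : ℕ) (x : ℙ ℂ (Fin (n + 1) → ℂ)) :
    veronese n d x =
      Projectivization.mk ℂ (veroneseVec n d x.rep) (veroneseVec_ne_zero n d x.rep_nonzero) := by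
  conv_lhs => rw [← x.mk_rep]
  rfl

/-- A linear relation between points of the Veronese variety is a relation between evaluations
of forms. -/
theorem sum_mul_eval_eq_zero_of_sum_smul_veroneseVec_eq_zero {n d : ℕ}
    {Z : Finset (ℙ ℂ (Fin (n + 1) → ℂ))} {c : ℙ ℂ (Fin (n + 1) → ℂ) → ℂ}
    (h : ∑ z ∈ Z, c z • veroneseVec n d z.rep = 0) {Q : MvPolynomial (Fin (n + 1)) ℂ}
    (hQ : Q.IsHomogeneous d) : ∑ z ∈ Z, c z * eval z.rep Q = 0 := by
  simp only [eval_eq, Finset.mul_sum]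
  rw [Finset.sum_comm]
  refine Finset.sum_eq_zero fun s hs => ?_
  have hn : ∑ i ∈ s.support, s i = d := (hQ.degree_eq_sum_deg_support hs).symm
  have h2 : ∀ v : Fin (n + 1) → ℂ,
      ((Finsupp.toMultiset s).map v).prod = ∏ i ∈ s.support, v i ^ s i := by
    intro v
    rw [Finset.prod_multiset_map_count, Finsupp.toFinset_toMultiset]
    simp only [Finsupp.count_toMultiset]
  have h1 : ∑ z ∈ Z, c z * ((Finsupp.toMultiset s).map z.rep).prod = 0 :=
    (Finset.sum_apply _ _ _).symm.trans
      (congrFun h ⟨Finsupp.toMultiset s, by rw [Finsupp.card_toMultiset]; exact hn⟩)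
  rw [← mul_zero (coeff s Q), ← h1, Finset.mul_sum]
  exact Finset.sum_congr rfl fun z _ => by rw [h2]; ring

/-- The rank is at most the number of terms of a linear combination of points of the Veronese
variety, whether or not the coefficients are nonzero. -/
theorem HasRank.le_card {n d k : ℕ} {P : ℙ ℂ (VeroneseSpace n d)}
    (hP : HasRank (veroneseVariety n d) P k) {S : Finset (ℙ ℂ (Fin (n + 1) → ℂ))}
    {a : ℙ ℂ (Fin (n + 1) → ℂ) → ℂ} (h0 : ∑ z ∈ S, a z • veroneseVec n d z.rep ≠ 0)
    (h : Projectivization.mk ℂ _ h0 = P) : k ≤ S.card := by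
  classical
  have hsum : ∑ i : Fin (S.filter fun z => a z ≠ 0).card,
      a ((S.filter fun z => a z ≠ 0).equivFin.symm i) • veroneseVec n d
        ((S.filter fun z => a z ≠ 0).equivFin.symm i).1.rep =
      ∑ z ∈ S, a z • veroneseVec n d z.rep := by
    rw [Equiv.sum_comp (S.filter fun z => a z ≠ 0).equivFin.symm
      (fun z => a z.1 • veroneseVec n d z.1.rep), Finset.sum_coe_sort (S.filter fun z => a z ≠ 0)
      (fun z => a z • veroneseVec n d z.rep), Finset.sum_filter_of_ne]
    rintro z - hz h1
    simp [h1] at hz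
  refine (hP.2 ⟨fun i => veronese n d ((S.filter fun z => a z ≠ 0).equivFin.symm i).1,
    fun i => ⟨_, rfl⟩, _, fun i => ⟨smul_ne_zero
      (Finset.mem_filter.mp ((S.filter fun z => a z ≠ 0).equivFin.symm i).2).2
      (veroneseVec_ne_zero n d
      ((S.filter fun z => a z ≠ 0).equivFin.symm i).1.rep_nonzero), ?_⟩,
    hsum.symm ▸ h0, ?_⟩).trans (Finset.card_filter_le _ _)
  · simp only [veronese_eq_mk]
    exact (Projectivization.mk_eq_mk_iff' ℂ _ _ _ _).mpr ⟨_, rfl⟩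
  · rw [← h]
    congr 1

/-- The points of a decomposition of minimal length are distinct, and the decomposition is a
linear combination with nonzero coefficients. -/
theorem HasRank.exists_coeff {n d k : ℕ} {P : ℙ ℂ (VeroneseSpace n d)}
    (hP : HasRank (veroneseVariety n d) P k) {x : Fin k → ℙ ℂ (Fin (n + 1) → ℂ)}
    (hx : IsSumOf P fun i => veronese n d (x i)) :
    Function.Injective x ∧ ∃ a : ℙ ℂ (Fin (n + 1) → ℂ) → ℂ, (∀ i, a (x i) ≠ 0) ∧
      ∃ h : ∑ i, a (x i) • veroneseVec n d (x i).rep ≠ 0, Projectivization.mk ℂ _ h = P := by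
  classical
  obtain ⟨w, hw, hs0, hs⟩ := hx
  have hα : ∀ i, ∃ α : ℂ, α • veroneseVec n d (x i).rep = w i := by
    intro i
    obtain ⟨hi0, hi⟩ := hw i
    simp only [veronese_eq_mk] at hi
    exact (Projectivization.mk_eq_mk_iff' ℂ _ _ _ _).mp hi
  choose α hα using hα
  have hα0 : ∀ i, α i ≠ 0 := by
    intro i hi
    refine (hw i).1 ?_
    rw [← hα, hi, zero_smul]
  have hinj : Function.Injective x := by
    -- collecting equal points would give a shorter decomposition
    have hsum : ∑ z ∈ Finset.univ.image x, (∑ i with x i = z, α i) • veroneseVec n d z.rep =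
        ∑ i, w i := by
      rw [← Finset.sum_fiberwise_of_maps_to
        (fun i _ => Finset.mem_image_of_mem x (Finset.mem_univ i))]
      refine Finset.sum_congr rfl fun z _ => ?_
      rw [Finset.sum_smul]
      refine Finset.sum_congr rfl fun i hi => ?_
      rw [← hα, (Finset.mem_filter.mp hi).2]
    have hle := hP.le_card (S := Finset.univ.image x) (a := fun z => ∑ i with x i = z, α i)
      (hsum ▸ hs0) (by rw [← hs]; congr 1)
    rw [← Set.injOn_univ, ← Finset.coe_univ, ← Finset.card_image_iff]
    exact le_antisymm Finset.card_image_le (by simpa using hle)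
  have hext : ∀ i, Function.extend x α 0 (x i) = α i := fun i => hinj.extend_apply _ _ _
  refine ⟨hinj, Function.extend x α 0, fun i => by rw [hext]; exact hα0 i, ?_⟩
  have hsum : ∑ i, Function.extend x α 0 (x i) • veroneseVec n d (x i).rep = ∑ i, w i :=
    Finset.sum_congr rfl fun i _ => by rw [hext, hα]
  exact ⟨hsum ▸ hs0, by rw [← hs]; congr 1⟩

theorem theorem1p1 (d k : ℕ) (P : ℙ ℂ (VeroneseSpace 2 d))
    (hrank : HasRank (veroneseVariety 2 d) P k)
    (x : Fin k → ℙ ℂ (Fin 3 → ℂ))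
    (hsum : IsSumOf P (fun i => veronese 2 d (x i)))
    (hgup : HasGUP (n := 2) (Set.range x))
    (hk : (k : ℝ) < ((d : ℝ) ^ 2 + 2 * (d : ℝ)) / 8) :
    IsIdentifiable (veroneseVariety 2 d) P := by
  classical
  refine ⟨k, hrank, fun i => veronese 2 d (x i), fun i => ⟨_, rfl⟩, hsum, fun q hq hqsum => ?_⟩
  choose y hy using hq
  obtain rfl : (fun i => veronese 2 d (y i)) = q := funext hy
  obtain ⟨hxinj, a, ha, ha0, haP⟩ := hrank.exists_coeff hsum
  obtain ⟨hyinj, b, -, hb0, hbP⟩ := hrank.exists_coeff hqsum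
  obtain ⟨t, ht⟩ := (Projectivization.mk_eq_mk_iff' ℂ _ _ ha0 hb0).mp (haP.trans hbP.symm)
  set A := Finset.univ.image x with hA
  set B := Finset.univ.image y with hB
  have hAk : A.card = k := by
    rw [hA, Finset.card_image_of_injective _ hxinj, Finset.card_univ, Fintype.card_fin]
  have hBk : B.card = k := by
    rw [hB, Finset.card_image_of_injective _ hyinj, Finset.card_univ, Fintype.card_fin]
  by_cases hAB : A = B
  · have hmem : ∀ i, ∃ j, x j = y i := by
      intro i
      have : y i ∈ A := hAB ▸ Finset.mem_image_of_mem y (Finset.mem_univ i)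
      simpa [hA] using this
    choose σ hσ using hmem
    have hσinj : Function.Injective σ := fun i j hij => hyinj (by rw [← hσ, ← hσ, hij])
    refine ⟨Equiv.ofBijective σ (Finite.injective_iff_bijective.mp hσinj), fun i => ?_⟩
    simp [hσ]
  exfalso
  set c : ℙ ℂ (Fin 3 → ℂ) → ℂ := fun z =>
    (if z ∈ A then a z else 0) - (if z ∈ B then t * b z else 0) with hc
  have haA : ∀ z ∈ A, a z ≠ 0 := by
    intro z hz
    obtain ⟨i, -, rfl⟩ := Finset.mem_image.mp hz
    exact ha i
  have hvec : ∑ z ∈ (A ∪ B).filter (fun z => c z ≠ 0), c z • veroneseVec 2 d z.rep = 0 := by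
    rw [Finset.sum_filter_of_ne (p := fun z => c z ≠ 0)
      (fun z _ hz h0 => hz (by rw [h0, zero_smul]))]
    simp only [hc, sub_smul, ite_smul, zero_smul, Finset.sum_sub_distrib, Finset.sum_ite_mem,
      Finset.union_inter_cancel_left, Finset.union_inter_cancel_right]
    rw [hA, hB, Finset.sum_image hxinj.injOn, Finset.sum_image hyinj.injOn, ← ht, Finset.smul_sum]
    simp [mul_smul]
  set Z := (A ∪ B).filter (fun z => c z ≠ 0) with hZ
  have hsdiff : A \ B ⊆ Z ∩ A := by
    intro z hz
    rw [Finset.mem_sdiff] at hz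
    simp [hZ, hc, hz.1, hz.2, haA z hz.1]
  have hZA : Z \ A ⊆ B \ A := by
    intro z hz
    simp only [hZ, Finset.mem_sdiff, Finset.mem_filter, Finset.mem_union] at hz ⊢
    tauto
  have hcard1 := Finset.card_le_card hsdiff
  have hcard2 := Finset.card_le_card hZA
  have hcard3 := Finset.card_sdiff_comm (hAk.trans hBk.symm)
  have hcard4 := Finset.card_sdiff_add_card_inter Z A
  have hcard5 : Z.card ≤ A.card + B.card :=
    (Finset.card_filter_le _ _).trans (Finset.card_union_le _ _)
  have hZne : Z.Nonempty := by
    have : (A \ B).Nonempty := by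
      rw [Finset.sdiff_nonempty]
      exact fun h => hAB (Finset.eq_of_subset_of_card_le h (by rw [hAk, hBk]))
    exact (this.mono hsdiff).mono Finset.inter_subset_left
  have hk' : 8 * k < d ^ 2 + 2 * d := by
    have : (8 * k : ℝ) < (d : ℝ) ^ 2 + 2 * d := by linarith
    exact_mod_cast this
  refine not_exists_relation (T := Z ∩ A) hZne (fun z hz => (Finset.mem_filter.mp hz).2)
    (fun Q hQ => sum_mul_eval_eq_zero_of_sum_smul_veroneseVec_eq_zero hvec hQ)
    Finset.inter_subset_left (by omega) ?_ (by omega)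
  intro u F hF0 hF hFZ
  by_contra! hle
  refine hgup (Z ∩ A) (fun z hz => ?_) u hle ⟨F, hF0, hF, ?_⟩
  · have : z ∈ A := (Finset.mem_inter.mp hz).2
    simpa [hA] using this
  · rintro p hp v hv rfl
    exact (eval_rep_mk_eq_zero_iff hF hv).mp (hFZ _ hp)
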